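/- For a non-negative integer $n$, let $b_8(n)$ denote the number of $8$-regular partitions of $n$, i.e. the number of partitions of $n$ into positive integers none of which is divisible by $8$. Let $n$ be a positive integer. Then $b_8(n)$ is odd if and only if $$24n+7 = p^{4a+1}m^2$$ for some prime $p$, some integer $a\ge 0$ and some positive integer $m$ with $p\nmid m$. Moreover, whenever $24n+7=p^{4a+1}m^2$ with $p$, $a$, $m$ as above, one has $p\equiv 7\pmod{24}$. -/

import Mathlib

/-- The number `b_ℓ(n)` of `ℓ`-regular partitions of `n`: partitions of `n` into positive integers
none of which is divisible by `ℓ`. -/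
def regularPartitionCount (ℓ n : ℕ) : ℕ :=
  (Nat.Partition.restricted n (fun i => ¬ ℓ ∣ i)).card

/-!
Modulo 2 the generating function of `b₈` is `P ^ 7`, where `P = ∏ (1 - X ^ k)`, and Euler's
pentagonal number theorem says that `P` is `∑ X ^ pentagonal k`. By the Frobenius map `P ^ 4` is
`∑ X ^ (4 * pentagonal k)`, and `P ^ 3` is `∑ X ^ hexagonal j`: a shear of `ℤ × ℤ` makes the
exponents of `P * ∑ X ^ hexagonal j` invariant under an involution whose fixed points give
`P ^ 4`. Completing squares, `b₈ n` has the parity of the number of positive solutions of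
`3 x ^ 2 + 4 y ^ 2 = 24 n + 7`.

These solutions are the fixed points of an involution on a finite set of representations of
`24 n + 7` by `3 x ^ 2 + 4 y z`. A second involution on the same set fixes exactly the points that
correspond to factorizations `24 n + 7 = d * e` with `d < e`. So `b₈ n` has the parity of half the
number of divisors of `24 n + 7`.
-/

open PowerSeries Set

theorem ncard_modEq_two_ncard_fixedPoints {α : Type*} {s : Set α} (hs : s.Finite) {σ : α → α}
    (hmaps : MapsTo σ s s) (hinv : ∀ x ∈ s, σ (σ x) = x) :
    s.ncard ≡ {x ∈ s | σ x = x}.ncard [MOD 2] := by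
  classical
  have hmoved : Even {x ∈ hs.toFinset | σ x ≠ x}.card := by
    rw [← ZMod.natCast_eq_zero_iff_even, Finset.card_eq_sum_ones, Nat.cast_sum]
    refine Finset.sum_involution (fun x _ => σ x) (fun _ _ => by decide) ?_ ?_ ?_ <;>
      simp only [Finset.mem_filter, hs.mem_toFinset]
    · exact fun x hx _ => hx.2
    · exact fun x hx => ⟨hmaps hx.1, fun h => hx.2 (h.symm.trans (hinv x hx.1))⟩
    · exact fun x hx => hinv x hx.1
  have hfixed : {x ∈ s | σ x = x} = ({x ∈ hs.toFinset | σ x = x} : Finset α) := by ext; simp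
  rw [hfixed, ncard_coe_finset, ncard_eq_toFinset_card s hs,
    ← Finset.card_filter_add_card_filter_not (s := hs.toFinset) (fun x => σ x = x)]
  exact (Nat.ModEq.refl _).add hmoved.two_dvd.modEq_zero_nat

section FiberSeries

variable {ι κ : Type*} {f : ι → ℕ} {g : κ → ℕ}

/-- The generating function `∑ i, X ^ f i` of a statistic `f : ι → ℕ`. It is only meaningful when
the fibres of `f` are finite: an infinite fibre contributes the coefficient `0`. -/
noncomputable def fiberSeries (R : Type*) [Semiring R] (f : ι → ℕ) : R⟦X⟧ :=
  .mk fun n => ((f ⁻¹' {n}).ncard : R)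

theorem fiberSeries_comp_equiv (R : Type*) [Semiring R] (f : ι → ℕ) (e : κ ≃ ι) :
    fiberSeries R (f ∘ e) = fiberSeries R f := by
  ext n
  rw [fiberSeries, fiberSeries, coeff_mk, coeff_mk, preimage_comp,
    ncard_preimage_of_injective_subset_range e.injective (by simp)]

theorem fiber_add_eq_biUnion (f : ι → ℕ) (g : κ → ℕ) (n : ℕ) :
    (fun p : ι × κ => f p.1 + g p.2) ⁻¹' {n} =
      ⋃ m ∈ (Finset.HasAntidiagonal.antidiagonal n : Set (ℕ × ℕ)),
        (f ⁻¹' {m.1}) ×ˢ (g ⁻¹' {m.2}) := by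
  ext p
  simp [eq_comm]

theorem finite_fiber_add (hf : ∀ n, (f ⁻¹' {n}).Finite) (hg : ∀ n, (g ⁻¹' {n}).Finite) (n : ℕ) :
    ((fun p : ι × κ => f p.1 + g p.2) ⁻¹' {n}).Finite := by
  rw [fiber_add_eq_biUnion]
  exact (Finset.finite_toSet _).biUnion fun m _ => (hf m.1).prod (hg m.2)

theorem fiberSeries_mul (R : Type*) [Semiring R] (hf : ∀ n, (f ⁻¹' {n}).Finite)
    (hg : ∀ n, (g ⁻¹' {n}).Finite) :
    fiberSeries R f * fiberSeries R g = fiberSeries R fun p : ι × κ => f p.1 + g p.2 := by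
  ext n
  have hdisj : (Finset.HasAntidiagonal.antidiagonal n : Set (ℕ × ℕ)).PairwiseDisjoint
      fun m => (f ⁻¹' {m.1}) ×ˢ (g ⁻¹' {m.2}) := by
    refine fun m _ m' _ hne => Set.disjoint_left.2 fun p hp hp' => hne (Prod.ext ?_ ?_)
    · exact hp.1.symm.trans hp'.1
    · exact hp.2.symm.trans hp'.2
  simp only [fiberSeries, coeff_mul, coeff_mk]
  rw [fiber_add_eq_biUnion, (Finset.finite_toSet _).ncard_biUnion
    (fun m _ => (hf m.1).prod (hg m.2)) hdisj, finsum_mem_coe_finset, Nat.cast_sum]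
  simp only [ncard_prod, Nat.cast_mul]

theorem fiberSeries_eq_of_involutive (hf : ∀ n, (f ⁻¹' {n}).Finite) {σ : ι → ι}
    (hσ : Function.Involutive σ) (hfσ : ∀ i, f (σ i) = f i) {e : κ → ι}
    (he : Function.Injective e) (hfixed : range e = Function.fixedPoints σ) :
    fiberSeries (ZMod 2) f = fiberSeries (ZMod 2) (f ∘ e) := by
  ext n
  have h := ncard_modEq_two_ncard_fixedPoints (hf n) (σ := σ)
    (fun i hi => (hfσ i).trans hi) (fun i _ => hσ i)
  have himage : e '' (f ∘ e ⁻¹' {n}) = {i ∈ f ⁻¹' {n} | σ i = i} := by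
    rw [preimage_comp, image_preimage_eq_inter_range, hfixed]
    rfl
  simp only [fiberSeries, coeff_mk]
  rw [(ZMod.natCast_eq_natCast_iff _ _ 2).2 h, ← himage, ncard_image_of_injective _ he]

theorem fiberSeries_sq (hf : ∀ n, (f ⁻¹' {n}).Finite) :
    fiberSeries (ZMod 2) f ^ 2 = fiberSeries (ZMod 2) fun i => 2 * f i := by
  rw [sq, fiberSeries_mul _ hf hf, fiberSeries_eq_of_involutive (finite_fiber_add hf hf)
    (fun p => p.swap_swap) (fun p => add_comm _ _) (e := fun i => (i, i))
    (fun _ _ h => congrArg Prod.fst h) (by ext ⟨i, j⟩; simp [Function.IsFixedPt, eq_comm])]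
  simp only [Function.comp_def, two_mul]

end FiberSeries

theorem finite_fiber_of_injective {ι : Type*} {f : ι → ℕ} (hf : Function.Injective f) (n : ℕ) :
    (f ⁻¹' {n}).Finite :=
  (finite_singleton n).preimage hf.injOn

theorem pentagonalSeries_zmod_two :
    pentagonalSeries (ZMod 2) = fiberSeries (ZMod 2) pentagonal := by
  ext n
  rw [fiberSeries, coeff_mk]
  by_cases hn : n ∈ range pentagonal
  · obtain ⟨k, rfl⟩ := hn
    have hfiber : pentagonal ⁻¹' {pentagonal k} = {k} := by
      ext; simp [pentagonal_inj]
    have hsign : ((k.negOnePow : ℤ) : ZMod 2) = 1 := by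
      rcases Int.units_eq_one_or k.negOnePow with h | h <;> rw [h] <;> decide
    rw [coeff_pentagonalSeries_pentagonal, hsign, hfiber, ncard_singleton, Nat.cast_one]
  · rw [coeff_pentagonalSeries_eq_zero _ hn, preimage_singleton_eq_empty.2 hn, ncard_empty,
      Nat.cast_zero]

theorem pentagonalSeries_pow_four :
    pentagonalSeries (ZMod 2) ^ 4 = fiberSeries (ZMod 2) fun k => 4 * pentagonal k := by
  have hinj : Function.Injective fun k => 2 * pentagonal k :=
    (mul_right_injective₀ two_ne_zero).comp pentagonal_injective
  rw [pow_mul _ 2 2, pentagonalSeries_zmod_two,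
    fiberSeries_sq (finite_fiber_of_injective pentagonal_injective),
    fiberSeries_sq (finite_fiber_of_injective hinj)]
  simp only [← mul_assoc, Nat.reduceMul]

/-- The generalized hexagonal numbers `j (2 j - 1)`, `j : ℤ`; these are all the triangular numbers,
each attained once. -/
def hexagonal (j : ℤ) : ℕ := (j * (2 * j - 1)).toNat

theorem natCast_hexagonal (j : ℤ) : (hexagonal j : ℤ) = j * (2 * j - 1) := by
  refine Int.toNat_of_nonneg ?_
  rcases le_or_gt j 0 with hj | hj <;> nlinarith

theorem hexagonal_injective : Function.Injective hexagonal := by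
  intro i j h
  have h' : (i - j) * (2 * (i + j) - 1) = 0 := by
    linear_combination congrArg (Nat.cast : ℕ → ℤ) h - natCast_hexagonal i + natCast_hexagonal j
  rcases mul_eq_zero.1 h' with h | h <;> omega

/-- A change of variables on `ℤ × ℤ` that turns `pentagonal k + hexagonal j` into an integral
quadratic form plus a linear form. It comes from the norm of the Eisenstein integers: in
`24 n + 4 = (6 k - 1) ^ 2 + 3 (4 j - 1) ^ 2` the right side is of the form `a ^ 2 + 3 b ^ 2` with
`a`, `b` odd. -/
def eisensteinShear : ℤ × ℤ ≃ ℤ × ℤ :=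
  (Equiv.refl ℤ).prodShear fun k =>
    if Even k then Equiv.subLeft (3 * (k / 2)) else Equiv.subRight (3 * (k / 2) + 1)

theorem pentagonal_add_hexagonal_eisensteinShear (p : ℤ × ℤ) :
    ((pentagonal (eisensteinShear p).1 + hexagonal (eisensteinShear p).2 : ℕ) : ℤ) =
      6 * p.1 ^ 2 - 6 * p.1 * p.2 + 2 * p.2 ^ 2 - 2 * p.1 + p.2 := by
  obtain ⟨k, b⟩ := p
  have hpent := two_mul_natCast_pentagonal k
  have hhex := natCast_hexagonal (eisensteinShear (k, b)).2
  refine mul_left_cancel₀ (two_ne_zero (α := ℤ)) ?_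
  push_cast
  change 2 * ((pentagonal k : ℤ) + _) = _
  rcases Int.even_or_odd' k with ⟨c, rfl | rfl⟩
  · have hj : (eisensteinShear (2 * c, b)).2 = 3 * c - b := by
      simp [eisensteinShear]
    rw [hj] at hhex ⊢
    linear_combination hpent + 2 * hhex
  · have hj : (eisensteinShear (2 * c + 1, b)).2 = b - (3 * c + 1) := by
      have hhalf : (2 * c + 1) / 2 = c := by omega
      simp only [eisensteinShear, Equiv.prodShear_apply, if_neg (Int.not_even_two_mul_add_one c),
        hhalf, Equiv.subRight_apply]
    rw [hj] at hhex ⊢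
    linear_combination hpent + 2 * hhex

theorem pentagonalSeries_mul_fiberSeries_hexagonal :
    pentagonalSeries (ZMod 2) * fiberSeries (ZMod 2) hexagonal = pentagonalSeries (ZMod 2) ^ 4 := by
  have hP := finite_fiber_of_injective pentagonal_injective
  have hH := finite_fiber_of_injective hexagonal_injective
  have hfinite (n : ℕ) :
      ((fun p => pentagonal p.1 + hexagonal p.2) ∘ eisensteinShear ⁻¹' {n}).Finite := by
    rw [preimage_comp]
    exact (finite_fiber_add hP hH n).preimage eisensteinShear.injective.injOn
  have hform := pentagonal_add_hexagonal_eisensteinShear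
  rw [pentagonalSeries_pow_four, pentagonalSeries_zmod_two, fiberSeries_mul _ hP hH,
    ← fiberSeries_comp_equiv _ _ eisensteinShear,
    fiberSeries_eq_of_involutive hfinite (σ := fun p => (p.1 - p.2, -p.2)) (e := fun k => (k, 0))]
  · congr 1
    ext k
    refine Nat.cast_injective (R := ℤ) ((hform (k, 0)).trans ?_)
    push_cast
    linear_combination -2 * two_mul_natCast_pentagonal k
  · rintro ⟨k, b⟩
    simp
  · intro p
    refine Nat.cast_injective (R := ℤ) ((hform _).trans (.trans ?_ (hform p).symm))
    ring
  · exact fun _ _ h => congrArg Prod.fst h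
  · ext ⟨k, b⟩
    simp only [mem_range, Function.mem_fixedPoints, Function.IsFixedPt, Prod.mk.injEq]
    grind

theorem pentagonalSeries_pow_three :
    pentagonalSeries (ZMod 2) ^ 3 = fiberSeries (ZMod 2) hexagonal := by
  have hP : pentagonalSeries (ZMod 2) ≠ 0 := fun h => by
    simpa [h] using coeff_pentagonalSeries_pentagonal (ZMod 2) 0
  refine mul_left_cancel₀ hP ?_
  rw [pentagonalSeries_mul_fiberSeries_hexagonal, ← pow_succ']

theorem sum_range_prime_pow_pow {R : Type*} [CommRing R] [IsDomain R] (p : ℕ) [Fact p.Prime]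
    [CharP R p] (r : ℕ) {y : R} (hy : y ≠ 1) :
    ∑ i ∈ Finset.range (p ^ r), y ^ i = (1 - y) ^ (p ^ r - 1) := by
  refine mul_right_cancel₀ (sub_ne_zero_of_ne hy.symm) ?_
  rw [geom_sum_mul_neg, pow_sub_one_mul (pow_pos (Fact.out : p.Prime).pos r).ne', sub_pow_char_pow,
    one_pow]

instance charP_powerSeries (R : Type*) [CommRing R] (p : ℕ) [CharP R p] : CharP R⟦X⟧ p :=
  charP_of_injective_ringHom C_injective p

open PowerSeries.WithPiTopology in
theorem mk_regularPartitionCount_prime_pow (p : ℕ) [Fact p.Prime] (r : ℕ) :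
    (.mk fun n => (regularPartitionCount (p ^ r) n : ZMod p)) =
      pentagonalSeries (ZMod p) ^ (p ^ r - 1) := by
  have hpos : 0 < p ^ r := pow_pos (Fact.out : p.Prime).pos r
  have hX (k : ℕ) : (X : (ZMod p)⟦X⟧) ^ (k + 1) ≠ 1 := fun h => by
    simpa using congrArg constantCoeff h
  have hregular := Nat.Partition.hasProd_powerSeriesMk_card_countRestricted (ZMod p) hpos
  simp only [pow_mul, sum_range_prime_pow_pow p r (hX _)] at hregular
  rw [← Nat.Partition.powerSeriesMk_card_restricted_eq_powerSeriesMk_card_countRestricted _ hpos]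
    at hregular
  exact hregular.unique ((hasProd_one_sub_X_pow (ZMod p)).pow _)

theorem regularPartitionCount_eight_modEq (n : ℕ) :
    regularPartitionCount 8 n ≡
      {p : ℤ × ℤ | hexagonal p.1 + 4 * pentagonal p.2 = n}.ncard [MOD 2] := by
  have hinj : Function.Injective fun k => 4 * pentagonal k :=
    (mul_right_injective₀ four_ne_zero).comp pentagonal_injective
  have hseries : (.mk fun n => (regularPartitionCount 8 n : ZMod 2)) =
      fiberSeries (ZMod 2) fun p : ℤ × ℤ => hexagonal p.1 + 4 * pentagonal p.2 := by
    rw [← fiberSeries_mul _ (finite_fiber_of_injective hexagonal_injective)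
      (finite_fiber_of_injective hinj), ← pentagonalSeries_pow_three, ← pentagonalSeries_pow_four,
      ← pow_add]
    exact mk_regularPartitionCount_prime_pow 2 3
  rw [← ZMod.natCast_eq_natCast_iff]
  simpa only [fiberSeries, coeff_mk] using! congrArg (coeff n) hseries

theorem abs_four_mul_sub_one_injective : Function.Injective fun j : ℤ => |4 * j - 1| := by
  intro i j h
  rcases abs_eq_abs.1 h with h | h <;> omega

theorem abs_six_mul_sub_one_injective : Function.Injective fun k : ℤ => |6 * k - 1| := by
  intro i j h
  rcases abs_eq_abs.1 h with h | h <;> omega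

theorem exists_abs_four_mul_sub_one_eq {x : ℤ} (hx : 0 < x) (hodd : Odd x) :
    ∃ j : ℤ, |4 * j - 1| = x := by
  have hmod : x % 4 = 3 ∨ x % 4 = 1 := by
    have := Int.odd_iff.1 hodd
    omega
  rcases hmod with h | h
  · exact ⟨(x + 1) / 4, by rw [abs_of_pos] <;> omega⟩
  · exact ⟨(1 - x) / 4, by rw [abs_of_neg] <;> omega⟩

theorem exists_abs_six_mul_sub_one_eq {y : ℤ} (hy : 0 < y) (hmod : y % 6 = 5 ∨ y % 6 = 1) :
    ∃ k : ℤ, |6 * k - 1| = y := by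
  rcases hmod with h | h
  · exact ⟨(y + 1) / 6, by rw [abs_of_pos] <;> omega⟩
  · exact ⟨(1 - y) / 6, by rw [abs_of_neg] <;> omega⟩

theorem emod_of_three_mul_sq_add_four_mul_sq {x y n : ℤ}
    (h : 3 * x ^ 2 + 4 * y ^ 2 = 24 * n + 7) : Odd x ∧ (y % 6 = 5 ∨ y % 6 = 1) := by
  have hresidues : ∀ x y : ZMod 24, 3 * x ^ 2 + 4 * y ^ 2 = 7 →
      x.val % 2 = 1 ∧ (y.val % 6 = 5 ∨ y.val % 6 = 1) := by decide
  have hcast : (3 * x ^ 2 + 4 * y ^ 2 : ZMod 24) = 7 := by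
    have h24 : (24 : ZMod 24) = 0 := rfl
    simpa [h24] using congrArg (Int.cast : ℤ → ZMod 24) h
  have hx := ZMod.val_intCast (n := 24) x
  have hy := ZMod.val_intCast (n := 24) y
  have := hresidues x y hcast
  rw [Int.odd_iff]
  omega

theorem ncard_hexagonal_add_four_mul_pentagonal (n : ℕ) :
    {p : ℤ × ℤ | hexagonal p.1 + 4 * pentagonal p.2 = n}.ncard =
      {p : ℤ × ℤ | 3 * p.1 ^ 2 + 4 * p.2 ^ 2 = 24 * n + 7 ∧ 0 < p.1 ∧ 0 < p.2}.ncard := by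
  have hform (j k : ℤ) : 3 * |4 * j - 1| ^ 2 + 4 * |6 * k - 1| ^ 2 = 24 * (n : ℤ) + 7 ↔
      hexagonal j + 4 * pentagonal k = n := by
    have hj := natCast_hexagonal j
    have hk := two_mul_natCast_pentagonal k
    simp only [sq_abs]
    zify
    constructor <;> intro h <;> linarith
  have hinj := abs_four_mul_sub_one_injective.prodMap abs_six_mul_sub_one_injective
  refine BijOn.ncard_eq (.mk (fun p hp => ?_) hinj.injOn ?_)
  · refine ⟨(hform _ _).2 hp, abs_pos.2 ?_, abs_pos.2 ?_⟩ <;> omega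
  · rintro ⟨x, y⟩ ⟨hxy, hx, hy⟩
    obtain ⟨hx_mod, hy_mod⟩ := emod_of_three_mul_sq_add_four_mul_sq hxy
    obtain ⟨j, rfl⟩ := exists_abs_four_mul_sub_one_eq hx hx_mod
    obtain ⟨k, rfl⟩ := exists_abs_six_mul_sub_one_eq hy hy_mod
    exact ⟨(j, k), (hform j k).1 hxy, rfl⟩

section Zagier

/-- The representations of `N` by the ternary form `3 x ^ 2 + 4 y z` inside the cone `0 < y`,
`2 (y - z) < 3 x`, in the style of Zagier's one-sentence proof of the two-squares theorem. The cone
is chosen so that the set is finite and both `zagierReflection` and `zagierFlip` preserve it. -/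
def zagierSet (N : ℕ) : Set (ℤ × ℤ × ℤ) :=
  {(x, y, z) | 3 * x ^ 2 + 4 * y * z = N ∧ 0 < y ∧ 2 * (y - z) < 3 * x}

theorem finite_zagierSet (N : ℕ) : (zagierSet N).Finite := by
  refine ((finite_Icc (-2 * N : ℤ) (2 * N)).prod ((finite_Icc (0 : ℤ) N).prod
    (finite_Icc (-4 * N : ℤ) (4 * N)))).subset ?_
  rintro ⟨x, y, z⟩ ⟨hform, hy, hcone⟩
  have hdecomp : (N : ℤ) = 3 * (x - y) ^ 2 + y ^ 2 + 2 * y * (3 * x - 2 * y + 2 * z) := by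
    linear_combination -hform
  have hw : 0 < 3 * x - 2 * y + 2 * z := by linarith
  have hyN : y ≤ N := by nlinarith [sq_nonneg (x - y), mul_pos hy hw]
  have hxyN : |x - y| ≤ N := by
    have : |x - y| ≤ (x - y) ^ 2 := by simpa using! Int.natAbs_le_self_sq (x - y)
    nlinarith [sq_nonneg y, mul_pos hy hw]
  have hwN : 3 * x - 2 * y + 2 * z ≤ N := by nlinarith [sq_nonneg (x - y), sq_nonneg y]
  rw [abs_le] at hxyN
  simp only [mem_prod, mem_Icc]
  omega

/-- An involution of `zagierSet N`: it fixes `y` and is a reflection for the form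
`3 x ^ 2 + 4 y z`. -/
def zagierReflection : ℤ × ℤ × ℤ → ℤ × ℤ × ℤ
  | (x, y, z) => (2 * y - x, y, z + 3 * x - 3 * y)

/-- An involution of `zagierSet N` for `N ≡ 7 [MOD 12]`: each of the three rules preserves the form
`3 x ^ 2 + 4 y z`, and the case distinction picks one that stays in the cone. -/
def zagierFlip : ℤ × ℤ × ℤ → ℤ × ℤ × ℤ
  | (x, y, z) =>
    if z < 0 then (x, -z, -y) else if 3 * x < 2 * (z - y) then (-x, y, z) else (x, z, y)

theorem zagierReflection_involutive : Function.Involutive zagierReflection := by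
  rintro ⟨x, y, z⟩
  simp only [zagierReflection, Prod.mk.injEq, true_and]
  constructor <;> ring

theorem mapsTo_zagierReflection (N : ℕ) :
    MapsTo zagierReflection (zagierSet N) (zagierSet N) := by
  rintro ⟨x, y, z⟩ ⟨hform, hy, hcone⟩
  refine ⟨?_, hy, ?_⟩
  · linear_combination hform
  · linarith

theorem four_dvd_sub_three_mul {d e : ℤ} (h : d * e % 4 = 3) : 4 ∣ e - 3 * d := by
  have hresidues : ∀ d e : ZMod 4, d * e = 3 → e - 3 * d = 0 := by decide
  change ((4 : ℕ) : ℤ) ∣ _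
  rw [← ZMod.intCast_zmod_eq_zero_iff_dvd]
  have hcast : (d * e : ZMod 4) = 3 := by
    have := ZMod.intCast_eq_intCast_iff' (d * e) 3 4
    simpa using this.2 h
  simpa using hresidues d e hcast

theorem fixedPoints_zagierReflection {N : ℕ} (hN : N % 4 = 3) :
    {t ∈ zagierSet N | zagierReflection t = t} =
      (fun p : ℕ × ℕ => ((p.1 : ℤ), (p.1 : ℤ), ((p.2 : ℤ) - 3 * p.1) / 4)) ''
        {p | p.1 * p.2 = N ∧ p.1 < p.2} := by
  ext ⟨x, y, z⟩
  constructor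
  · rintro ⟨⟨hform, hy, hcone⟩, hfix⟩
    obtain rfl : x = y := by
      simp only [zagierReflection, Prod.mk.injEq] at hfix
      omega
    lift x to ℕ using hy.le
    obtain ⟨e, he⟩ := Int.eq_ofNat_of_zero_le (a := 3 * x + 4 * z) (by linarith)
    refine ⟨(x, e), ⟨?_, by omega⟩, ?_⟩
    · zify
      linear_combination hform - x * he
    · simp only [← he, Prod.mk.injEq, true_and]
      omega
  · rintro ⟨⟨d, e⟩, ⟨rfl, hde⟩, h⟩
    obtain ⟨c, hc⟩ := four_dvd_sub_three_mul (d := d) (e := e) (mod_cast hN)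
    have hd : d ≠ 0 := by
      rintro rfl
      simp at hN
    simp only [hc, Prod.mk.injEq] at h
    obtain ⟨rfl, rfl, rfl⟩ := h
    refine ⟨⟨?_, by omega, by omega⟩, ?_⟩
    · push_cast
      rw [Int.mul_ediv_cancel_left c four_ne_zero]
      linear_combination -d * hc
    · simp only [zagierReflection, Prod.mk.injEq, true_and]
      omega

variable {N : ℕ} {x y z : ℤ}

theorem ne_zero_of_mem_zagierSet (hN : N % 12 = 7) (h : (x, y, z) ∈ zagierSet N) : z ≠ 0 := by
  rintro rfl
  have := h.1
  omega

theorem three_mul_ne_of_mem_zagierSet (hN : N % 12 = 7) (h : (x, y, z) ∈ zagierSet N) :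
    3 * x ≠ 2 * (z - y) := by
  intro hx
  obtain ⟨c, rfl⟩ : Even x := by grind
  have := h.1
  ring_nf at this
  omega

theorem add_ne_zero_of_mem_zagierSet (hN : N % 12 = 7) (h : (x, y, z) ∈ zagierSet N) :
    y + z ≠ 0 := by
  intro hyz
  obtain rfl : z = -y := by omega
  have hform : 3 * x ^ 2 - 4 * y ^ 2 = N := by linear_combination h.1
  have hsq : y ^ 2 % 3 ≠ 2 := by
    rcases (by omega : y % 3 = 0 ∨ y % 3 = 1 ∨ y % 3 = 2) with h | h | h <;>
      simp [sq, Int.mul_emod, h]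
  omega

theorem mapsTo_zagierFlip (hN : N % 12 = 7) :
    MapsTo zagierFlip (zagierSet N) (zagierSet N) := by
  rintro ⟨x, y, z⟩ h
  have hz := ne_zero_of_mem_zagierSet hN h
  have hx := three_mul_ne_of_mem_zagierSet hN h
  obtain ⟨hform, hy, hcone⟩ := h
  simp only [zagierFlip]
  split_ifs with h₁ h₂ <;> refine ⟨?_, ?_, ?_⟩
  all_goals first | omega | linear_combination hform

theorem zagierFlip_zagierFlip (hN : N % 12 = 7) {t : ℤ × ℤ × ℤ} (ht : t ∈ zagierSet N) :
    zagierFlip (zagierFlip t) = t := by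
  obtain ⟨x, y, z⟩ := t
  have := ne_zero_of_mem_zagierSet hN ht
  have := three_mul_ne_of_mem_zagierSet hN ht
  obtain ⟨-, hy, hcone⟩ := ht
  simp only [zagierFlip]
  grind

theorem fixedPoints_zagierFlip (hN : N % 12 = 7) :
    {t ∈ zagierSet N | zagierFlip t = t} =
      (fun p : ℤ × ℤ => (p.1, p.2, p.2)) ''
        {p | 3 * p.1 ^ 2 + 4 * p.2 ^ 2 = N ∧ 0 < p.1 ∧ 0 < p.2} := by
  ext ⟨x, y, z⟩
  constructor
  · rintro ⟨ht, hfix⟩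
    have hyz := add_ne_zero_of_mem_zagierSet hN ht
    obtain ⟨hform, hy, hcone⟩ := ht
    simp only [zagierFlip] at hfix
    split_ifs at hfix with h₁ h₂ <;> simp only [Prod.mk.injEq] at hfix
    · omega
    · obtain rfl : x = 0 := by omega
      have hform' : 4 * (y * z) = N := by linear_combination hform
      omega
    · obtain rfl : z = y := by omega
      exact ⟨(x, z), ⟨by linear_combination hform, by omega, hy⟩, rfl⟩
  · rintro ⟨⟨a, b⟩, ⟨hform, ha, hb⟩, h⟩
    simp only [Prod.mk.injEq] at h
    obtain ⟨rfl, rfl, rfl⟩ := h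
    refine ⟨⟨by linear_combination hform, hb, by omega⟩, ?_⟩
    simp only [zagierFlip]
    grind

theorem ncard_reps_modEq_ncard_mul_eq_and_lt (hN : N % 12 = 7) :
    {p : ℤ × ℤ | 3 * p.1 ^ 2 + 4 * p.2 ^ 2 = N ∧ 0 < p.1 ∧ 0 < p.2}.ncard ≡
      {p : ℕ × ℕ | p.1 * p.2 = N ∧ p.1 < p.2}.ncard [MOD 2] := by
  have hflip := ncard_modEq_two_ncard_fixedPoints (finite_zagierSet N) (mapsTo_zagierFlip hN)
    fun _ => zagierFlip_zagierFlip hN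
  have hreflection := ncard_modEq_two_ncard_fixedPoints (finite_zagierSet N)
    (mapsTo_zagierReflection N) fun t _ => zagierReflection_involutive t
  rw [fixedPoints_zagierFlip hN, ncard_image_of_injective _ (by rintro ⟨⟩ ⟨⟩ h; simpa using! h)]
    at hflip
  rw [fixedPoints_zagierReflection (by omega), InjOn.ncard_image ?_] at hreflection
  · exact hflip.symm.trans hreflection
  · rintro ⟨d, e⟩ ⟨rfl, hde⟩ ⟨d', e'⟩ ⟨he, hde'⟩ h
    obtain rfl : d = d' := by simpa using! congrArg Prod.fst h
    have hd : d ≠ 0 := by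
      rintro rfl
      simp at hN
    obtain rfl : e' = e := mul_left_cancel₀ hd he
    rfl

end Zagier

theorem coe_divisorsAntidiagonal {n : ℕ} (hn : n ≠ 0) :
    (n.divisorsAntidiagonal : Set (ℕ × ℕ)) = {p | p.1 * p.2 = n} := by
  ext
  simp [hn]

theorem card_divisorsAntidiagonal (n : ℕ) : n.divisorsAntidiagonal.card = n.divisors.card := by
  rw [← Nat.map_div_right_divisors, Finset.card_map]

theorem odd_card_divisors_iff_isSquare {n : ℕ} (hn : n ≠ 0) :
    Odd n.divisors.card ↔ IsSquare n := by
  have hfixed : {p ∈ (n.divisorsAntidiagonal : Set (ℕ × ℕ)) | p.swap = p} =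
      (fun d => (d, d)) '' {d | n = d * d} := by
    ext ⟨d, e⟩
    simp only [coe_divisorsAntidiagonal hn, mem_ofPred_eq, Prod.swap_prod_mk, mem_image,
      Prod.mk.injEq]
    grind
  have hparity := ncard_modEq_two_ncard_fixedPoints (Finset.finite_toSet n.divisorsAntidiagonal)
    (σ := Prod.swap) (fun p hp => by simpa [mul_comm] using hp) (fun p _ => p.swap_swap)
  rw [ncard_coe_finset, card_divisorsAntidiagonal, hfixed,
    ncard_image_of_injective _ fun _ _ h => congrArg Prod.fst h] at hparity
  rw [Nat.odd_iff, hparity]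
  by_cases hsq : IsSquare n
  · obtain ⟨m, rfl⟩ := hsq
    have hroot : {d | m * m = d * d} = {m} := by
      ext d
      simp [← sq, eq_comm]
    simp [hroot]
  · have hroot : {d | n = d * d} = ∅ := eq_empty_of_forall_notMem fun d h => hsq ⟨d, h⟩
    simp [hroot, hsq]

theorem two_mul_ncard_mul_eq_and_lt {n : ℕ} (hn : ¬ IsSquare n) :
    2 * {p : ℕ × ℕ | p.1 * p.2 = n ∧ p.1 < p.2}.ncard = n.divisors.card := by
  have hn₀ : n ≠ 0 := by
    rintro rfl
    exact hn IsSquare.zero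
  set s := {p : ℕ × ℕ | p.1 * p.2 = n ∧ p.1 < p.2}
  have hunion : (n.divisorsAntidiagonal : Set (ℕ × ℕ)) = s ∪ Prod.swap '' s := by
    ext ⟨d, e⟩
    have hde : n = d * e → d ≠ e := by
      rintro h rfl
      exact hn ⟨d, h⟩
    simp only [coe_divisorsAntidiagonal hn₀, image_swap_eq_preimage_swap, mem_ofPred_eq, mem_union,
      mem_preimage, s, Prod.swap_prod_mk]
    grind
  have hs : s.Finite := (Finset.finite_toSet _).subset (hunion ▸ subset_union_left)
  have hdisj : Disjoint s (Prod.swap '' s) := by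
    rw [image_swap_eq_preimage_swap]
    exact disjoint_left.2 fun p hp hp' => hp.2.asymm hp'.2
  rw [← card_divisorsAntidiagonal, ← ncard_coe_finset, hunion,
    ncard_union_eq hdisj hs (hs.image _), ncard_image_of_injective _ Prod.swap_injective, two_mul]

theorem card_divisors_prime_pow_mul {p c : ℕ} (hp : p.Prime) (hpc : ¬ p ∣ c) (k : ℕ) :
    (p ^ k * c).divisors.card = (k + 1) * c.divisors.card := by
  rw [((hp.coprime_iff_not_dvd.2 hpc).pow_left k).card_divisors_mul, Nat.divisors_prime_pow hp]
  simp

theorem exists_eq_prime_pow_odd_mul {n : ℕ} (hn : ¬ IsSquare n) :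
    ∃ p k c : ℕ, p.Prime ∧ ¬ p ∣ c ∧ n = p ^ (2 * k + 1) * c := by
  obtain ⟨a, b, rfl, ha⟩ := Nat.sq_mul_squarefree n
  have ha_one : a ≠ 1 := by rintro rfl; simp [IsSquare.sq] at hn
  obtain ⟨p, hp, a, rfl⟩ := Nat.exists_prime_and_dvd ha_one
  have hb : b ≠ 0 := by rintro rfl; simp at hn
  obtain ⟨k, b, hpb, rfl⟩ := Nat.exists_eq_pow_mul_and_not_dvd hb p hp.ne_one
  refine ⟨p, k, b ^ 2 * a, hp, ?_, by ring⟩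
  have hpa : ¬ p ∣ a := fun h => hp.not_isUnit (ha p (mul_dvd_mul_left p h))
  exact hp.prime.not_dvd_mul (mt hp.dvd_of_dvd_pow hpb) hpa

theorem odd_ncard_mul_eq_and_lt_iff {n : ℕ} (hn : ¬ IsSquare n) :
    Odd {p : ℕ × ℕ | p.1 * p.2 = n ∧ p.1 < p.2}.ncard ↔
      ∃ p a m : ℕ, p.Prime ∧ ¬ p ∣ m ∧ n = p ^ (4 * a + 1) * m ^ 2 := by
  have hcard := two_mul_ncard_mul_eq_and_lt hn
  constructor
  · intro hodd
    obtain ⟨p, k, c, hp, hpc, rfl⟩ := exists_eq_prime_pow_odd_mul hn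
    have hc : c ≠ 0 := by rintro rfl; simp at hpc
    rw [card_divisors_prime_pow_mul hp hpc,
      show (2 * k + 1 + 1) * c.divisors.card = 2 * ((k + 1) * c.divisors.card) by ring] at hcard
    rw [mul_left_cancel₀ two_ne_zero hcard, Nat.odd_mul, odd_card_divisors_iff_isSquare hc] at hodd
    obtain ⟨hk, m, rfl⟩ := hodd
    obtain ⟨a, rfl⟩ : ∃ a, k = 2 * a :=
      even_iff_exists_two_mul.1 (Nat.not_odd_iff_even.1 (Nat.odd_add_one.1 hk))
    exact ⟨p, a, m, hp, fun h => hpc (h.mul_left m), by ring⟩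
  · rintro ⟨p, a, m, hp, hpm, rfl⟩
    have hm : m ≠ 0 := by rintro rfl; simp at hpm
    rw [card_divisors_prime_pow_mul hp (mt hp.dvd_of_dvd_pow hpm)] at hcard
    have hsq : Odd (m ^ 2).divisors.card :=
      (odd_card_divisors_iff_isSquare (pow_ne_zero 2 hm)).2 (IsSquare.sq m)
    have hpairs := mul_left_cancel₀ two_ne_zero
      (hcard.trans (show _ = 2 * ((2 * a + 1) * (m ^ 2).divisors.card) by ring))
    rw [hpairs]
    exact (odd_two_mul_add_one a).mul hsq

theorem modEq_seven_of_eq_pow_mul_sq {n p a m : ℕ} (h : 24 * n + 7 = p ^ (4 * a + 1) * m ^ 2) :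
    p ≡ 7 [MOD 24] := by
  have hresidues : ∀ p t : ZMod 24, p * t ^ 2 = 7 → p = 7 := by decide
  rw [← ZMod.natCast_eq_natCast_iff]
  have h24 : (24 : ZMod 24) = 0 := rfl
  refine hresidues p (p ^ (2 * a) * m) ?_
  have hcast := congrArg (Nat.cast : ℕ → ZMod 24) h
  push_cast at hcast
  rw [h24] at hcast
  linear_combination -hcast

theorem not_isSquare_of_mod_four_eq_three {n : ℕ} (hn : n % 4 = 3) : ¬ IsSquare n := by
  rintro ⟨m, rfl⟩
  have := m.mod_lt four_pos
  rw [Nat.mul_mod] at hn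
  interval_cases m % 4 <;> simp at hn

theorem theorem1p1 (n : ℕ) (hn : 0 < n) :
    (Odd (regularPartitionCount 8 n) ↔
      ∃ p a m : ℕ, p.Prime ∧ ¬ p ∣ m ∧ 24 * n + 7 = p ^ (4 * a + 1) * m ^ 2) ∧
    (∀ p a m : ℕ, p.Prime → ¬ p ∣ m → 24 * n + 7 = p ^ (4 * a + 1) * m ^ 2 →
      p ≡ 7 [MOD 24]) := by
  refine ⟨?_, fun p a m _ _ h => modEq_seven_of_eq_pow_mul_sq h⟩
  have hsquare : ¬ IsSquare (24 * n + 7) := not_isSquare_of_mod_four_eq_three (by omega)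
  have hparity := calc
    regularPartitionCount 8 n
      ≡ {p : ℤ × ℤ | hexagonal p.1 + 4 * pentagonal p.2 = n}.ncard [MOD 2] :=
        regularPartitionCount_eight_modEq n
    _ = {p : ℤ × ℤ | 3 * p.1 ^ 2 + 4 * p.2 ^ 2 = (24 * n + 7 : ℕ) ∧ 0 < p.1 ∧ 0 < p.2}.ncard :=
        mod_cast ncard_hexagonal_add_four_mul_pentagonal n
    _ ≡ {p : ℕ × ℕ | p.1 * p.2 = 24 * n + 7 ∧ p.1 < p.2}.ncard [MOD 2] :=
        ncard_reps_modEq_ncard_mul_eq_and_lt (by omega)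
  rw [← odd_ncard_mul_eq_and_lt_iff hsquare, Nat.odd_iff, Nat.odd_iff, hparity]
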